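/- **Conventions.** "Small" and "set" refer to a fixed universe. A *model category* is a complete and cocomplete, locally small category $\mathcal M$ with classes of cofibrations, fibrations and weak equivalences such that (acyclic cofibrations, fibrations) and (cofibrations, acyclic fibrations) are weak factorization systems (wfs) and the weak equivalences satisfy 2-out-of-3. A map in $\mathcal M$ is a *couniversal* (resp. *universal*) *weak equivalence* if every pushout (resp. every pullback) of it is a weak equivalence. If $(\mathcal L,\mathcal R)$ is a wfs on a category, an *$\mathcal L$-object* is an object $X$ with $(\emptyset\to X)\in\mathcal L$. For a small category $\mathcal K$ and $X:\mathcal K\to\mathcal M$, write $U\otimes_{\mathcal K}X$ for the colimit of $X$ weighted by $U:\mathcal K^{\mathrm{op}}\to\mathbf{Set}$ and $\{W,X\}^{\mathcal K}$ for the limit of $X$ weighted by $W:\mathcal K\to\mathbf{Set}$. **Bistratified categories.** *Abstract bigluing data* from $\mathcal A$ to $\mathcal D$ consist of functors $U:\mathcal A^{\mathrm{op}}\times\mathcal D\to\mathbf{Set}$ and $W:\mathcal D^{\mathrm{op}}\times\mathcal A\to\mathbf{Set}$ and maps $\alpha:W(d,c')\times U(c,d)\to\mathcal A(c,c')$, natural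 in $c,c'\in\mathcal A$ and dinatural in $d\in\mathcal D$. Their *collage* has as objects the disjoint union of those of $\mathcal A$ and $\mathcal D$, and as hom-sets $\mathcal A(c,c')$, $U(c,d)$ (from $c$ to $d$), $W(d,c)$ (from $d$ to $c$) and $\mathcal D(d,d')\sqcup\int^{c\in\mathcal A}U(c,d')\times W(d,c)$ (from $d$ to $d'$), with the evident composition. Let $\mathcal C$ be a small category with an ordinal degree $\deg x$ for each object $x$, and let $\mathcal C_\delta$ be the full subcategory on the objects of degree $<\delta$. Then $\mathcal C$ is *bistratified with discrete strata* if for every ordinal $\delta$ the inclusion $\mathcal C_\delta\hookrightarrow\mathcal C_{\delta+1}$ is isomorphic, under $\mathcal C_\delta$, to the inclusion of $\mathcal C_\delta$ in the collage of abstract bigluing data from $\mathcal C_\delta$ to some discrete category. The category $\mathcal C^{\mathrm{op}}$ is given the same degrees. **Reedy wfs.** For $A:\mathcal C\to\mathcal M$ and $x\in\mathcal C$ of degree $\delta$, let $L_xA=\mathcal C(-,x)\otimes_{\mathcal C_\delta}A$ and $M_xA=\{\mathcal C(x,-),A\}^{\mathcal C_\delta}$, with the canonical maps $L_xA\to A_x\to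 M_xA$. A wfs $(\mathcal L,\mathcal R)$ on a complete and cocomplete $\mathcal M$ induces the *Reedy wfs* on $\mathcal M^{\mathcal C}$: a map $A\to B$ is in its left class iff $L_xB\sqcup_{L_xA}A_x\to B_x$ is in $\mathcal L$ for all $x$, and in its right class iff $A_x\to M_xA\times_{M_xB}B_x$ is in $\mathcal R$ for all $x$. If $\mathcal M$ is a model category, the *Reedy acyclic cofibrations* (resp. *Reedy acyclic fibrations*) are the left class of the Reedy wfs induced by (acyclic cofibrations, fibrations) (resp. the right class of the Reedy wfs induced by (cofibrations, acyclic fibrations)). **Theorem.** Let $\mathcal C$ be bistratified with discrete strata, and suppose that for every model category $\mathcal M$ the two Reedy wfs on $\mathcal M^{\mathcal C}$, induced by (acyclic cofibrations, fibrations) and (cofibrations, acyclic fibrations), are respectively the (acyclic cofibration, fibration) and (cofibration, acyclic fibration) wfs of a model structure on $\mathcal M^{\mathcal C}$ whose weak equivalences are the objectwise weak equivalences. Let $U:\mathcal C^{\mathrm{op}}\to\mathbf{Set}$ and $W:\mathcal C\to\mathbf{Set}$, and give $\mathbf{Set}^{\mathcal C^{\mathrm{op}}}$ and $\mathbf{Set}^{\mathcal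 C}$ the Reedy wfs induced by the wfs (injections, surjections) on $\mathbf{Set}$. 1. The functor $U\otimes_{\mathcal C}(-):\mathcal M^{\mathcal C}\to\mathcal M$ takes Reedy acyclic cofibrations to couniversal weak equivalences for all model categories $\mathcal M$ if and only if $U$ is an $\mathcal L$-object of $\mathbf{Set}^{\mathcal C^{\mathrm{op}}}$. 2. The functor $\{W,-\}^{\mathcal C}:\mathcal M^{\mathcal C}\to\mathcal M$ takes Reedy acyclic fibrations to universal weak equivalences for all model categories $\mathcal M$ if and only if $W$ is an $\mathcal L$-object of $\mathbf{Set}^{\mathcal C}$. -/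

import Mathlib

open CategoryTheory CategoryTheory.Limits CategoryTheory.MorphismProperty Opposite HomotopicalAlgebra

universe v u

/-! ## Abstract bigluing data and their collages -/

/-- Abstract bigluing data from a category `A` to a category `D`: profunctors `U(c, d)`
(contravariant in `c : A`, covariant in `d : D`) and `W(d, c)` (contravariant in `d : D`,
covariant in `c : A`) together with a map `α : W ⊗_D U ⟶ A(-, -)` of profunctors, given by
maps `W(d, c') × U(c, d) → A(c, c')` natural in `c` and `c'` and balanced over `d`. -/
structure BigluingData (A : Type u) [SmallCategory A] (D : Type u) [SmallCategory D] where
  U : D ⥤ Aᵒᵖ ⥤ Type u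
  W : Dᵒᵖ ⥤ A ⥤ Type u
  α : ∀ {c c' : A} {d : D}, (U.obj d).obj (op c) → (W.obj (op d)).obj c' → (c ⟶ c')
  α_left : ∀ {b c c' : A} {d : D} (f : b ⟶ c) (s : (U.obj d).obj (op c))
    (t : (W.obj (op d)).obj c'), α ((U.obj d).map f.op s) t = f ≫ α s t
  α_right : ∀ {c c' b : A} {d : D} (s : (U.obj d).obj (op c))
    (t : (W.obj (op d)).obj c') (f : c' ⟶ b), α s ((W.obj (op d)).map f t) = α s t ≫ f
  α_balanced : ∀ {c c' : A} {d d' : D} (s : (U.obj d).obj (op c)) (g : d ⟶ d')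
    (t : (W.obj (op d')).obj c'), α ((U.map g).app (op c) s) t = α s ((W.map g.op).app c' t)

namespace BigluingData

variable {A : Type u} [SmallCategory A] {D : Type u} [SmallCategory D] (B : BigluingData A D)

/-- `b ⟶ c ⟶ d`. -/
def ul {b c : A} {d : D} (f : b ⟶ c) (s : (B.U.obj d).obj (op c)) : (B.U.obj d).obj (op b) :=
  (B.U.obj d).map f.op s

/-- `c ⟶ d ⟶ d'`. -/
def ur {c : A} {d d' : D} (s : (B.U.obj d).obj (op c)) (g : d ⟶ d') : (B.U.obj d').obj (op c) :=
  (B.U.map g).app (op c) s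

/-- `d ⟶ d' ⟶ c`. -/
def wl {d d' : D} {c : A} (g : d ⟶ d') (t : (B.W.obj (op d')).obj c) : (B.W.obj (op d)).obj c :=
  (B.W.map g.op).app c t

/-- `d ⟶ c ⟶ c'`. -/
def wr {d : D} {c c' : A} (t : (B.W.obj (op d)).obj c) (f : c ⟶ c') : (B.W.obj (op d)).obj c' :=
  (B.W.obj (op d)).map f t

section Laws

variable {a b c e : A} {d d' d'' : D}

lemma ul_id (s : (B.U.obj d).obj (op c)) : B.ul (𝟙 c) s = s := by simp [ul]

lemma ur_id (s : (B.U.obj d).obj (op c)) : B.ur s (𝟙 d) = s := by simp [ur]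

lemma wl_id (t : (B.W.obj (op d)).obj c) : B.wl (𝟙 d) t = t := by simp [wl]

lemma wr_id (t : (B.W.obj (op d)).obj c) : B.wr t (𝟙 c) = t := by simp [wr]

lemma ul_ul (f : a ⟶ b) (g : b ⟶ c) (s : (B.U.obj d).obj (op c)) :
    B.ul f (B.ul g s) = B.ul (f ≫ g) s := by simp [ul]

lemma ur_ur (s : (B.U.obj d).obj (op c)) (g : d ⟶ d') (h : d' ⟶ d'') :
    B.ur (B.ur s g) h = B.ur s (g ≫ h) := by simp [ur]

lemma ur_ul (f : b ⟶ c) (s : (B.U.obj d).obj (op c)) (g : d ⟶ d') :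
    B.ur (B.ul f s) g = B.ul f (B.ur s g) := by simp [ur, ul, NatTrans.naturality_apply]

lemma wl_wl (g : d ⟶ d') (h : d' ⟶ d'') (t : (B.W.obj (op d'')).obj c) :
    B.wl g (B.wl h t) = B.wl (g ≫ h) t := by simp [wl]

lemma wr_wr (t : (B.W.obj (op d)).obj a) (f : a ⟶ b) (g : b ⟶ c) :
    B.wr (B.wr t f) g = B.wr t (f ≫ g) := by simp [wr]

lemma wr_wl (g : d ⟶ d') (t : (B.W.obj (op d')).obj b) (f : b ⟶ c) :
    B.wr (B.wl g t) f = B.wl g (B.wr t f) := by simp [wr, wl, NatTrans.naturality_apply]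

lemma α_ul (f : a ⟶ b) (s : (B.U.obj d).obj (op b)) (t : (B.W.obj (op d)).obj c) :
    B.α (B.ul f s) t = f ≫ B.α s t := B.α_left f s t

lemma α_wr (s : (B.U.obj d).obj (op b)) (t : (B.W.obj (op d)).obj c) (f : c ⟶ e) :
    B.α s (B.wr t f) = B.α s t ≫ f := B.α_right s t f

lemma α_ur (s : (B.U.obj d).obj (op b)) (g : d ⟶ d') (t : (B.W.obj (op d')).obj c) :
    B.α (B.ur s g) t = B.α s (B.wl g t) := B.α_balanced s g t

end Laws

/-- The relation defining `(U ⊗_A W)(d, d')` as a quotient of `∐_c W(d, c) × U(c, d')`. -/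
inductive TensorRel (d d' : D) :
    (Σ c : A, (B.W.obj (op d)).obj c × (B.U.obj d').obj (op c)) →
    (Σ c : A, (B.W.obj (op d)).obj c × (B.U.obj d').obj (op c)) → Prop
  | mk {c c' : A} (k : c ⟶ c') (t : (B.W.obj (op d)).obj c) (s : (B.U.obj d').obj (op c')) :
      TensorRel d d' ⟨c, t, B.ul k s⟩ ⟨c', B.wr t k, s⟩

/-- The set `(U ⊗_A W)(d, d')` of formal composites `d ⟶ c ⟶ d'` through objects of `A`. -/
def Tensor (d d' : D) : Type u := Quot (B.TensorRel d d')

/-- The formal composite of `t : d ⟶ c` and `s : c ⟶ d'`. -/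
def tmk {d d' : D} {c : A} (t : (B.W.obj (op d)).obj c) (s : (B.U.obj d').obj (op c)) :
    B.Tensor d d' := Quot.mk _ ⟨c, t, s⟩

lemma tmk_ul {d d' : D} {c c' : A} (k : c ⟶ c') (t : (B.W.obj (op d)).obj c)
    (s : (B.U.obj d').obj (op c')) : B.tmk t (B.ul k s) = B.tmk (B.wr t k) s :=
  Quot.sound (TensorRel.mk k t s)

lemma tensor_ind {d d' : D} {P : B.Tensor d d' → Prop}
    (h : ∀ (c : A) (t : (B.W.obj (op d)).obj c) (s : (B.U.obj d').obj (op c)), P (B.tmk t s))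
    (q : B.Tensor d d') : P q := Quot.ind (fun p => h p.1 p.2.1 p.2.2) q

/-- Maps out of `(U ⊗_A W)(d, d')`. -/
def tlift {d d' : D} {X : Type u}
    (φ : ∀ {c : A}, (B.W.obj (op d)).obj c → (B.U.obj d').obj (op c) → X)
    (h : ∀ {c c' : A} (k : c ⟶ c') (t : (B.W.obj (op d)).obj c) (s : (B.U.obj d').obj (op c')),
      φ t (B.ul k s) = φ (B.wr t k) s) (q : B.Tensor d d') : X :=
  Quot.lift (fun p => φ p.2.1 p.2.2) (by rintro _ _ ⟨k, t, s⟩; exact h k t s) q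

/-- `c ⟶ d ⟶ d'` with the second arrow a formal composite. -/
def ut {c : A} {d d' : D} (s : (B.U.obj d).obj (op c)) : B.Tensor d d' → (B.U.obj d').obj (op c) :=
  B.tlift (fun t r => B.ul (B.α s t) r) (by intros; simp only [α_wr, ul_ul])

/-- `d ⟶ d' ⟶ c` with the first arrow a formal composite. -/
def tw {d d' : D} {c : A} (q : B.Tensor d d') (t : (B.W.obj (op d')).obj c) :
    (B.W.obj (op d)).obj c :=
  B.tlift (fun r s => B.wr r (B.α s t)) (by intros; simp only [α_ul, wr_wr]) q

/-- `d ⟶ d' ⟶ d''` with the second arrow a formal composite. -/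
def dt {d d' d'' : D} (g : d ⟶ d') : B.Tensor d' d'' → B.Tensor d d'' :=
  B.tlift (fun t s => B.tmk (B.wl g t) s) (by intros; simp only [tmk_ul, wr_wl])

/-- `d ⟶ d' ⟶ d''` with the first arrow a formal composite. -/
def td {d d' d'' : D} (q : B.Tensor d d') (g : d' ⟶ d'') : B.Tensor d d'' :=
  B.tlift (fun t s => B.tmk t (B.ur s g)) (by intros; simp only [← tmk_ul, ur_ul]) q

/-- `d ⟶ d' ⟶ d''` with both arrows formal composites. -/
def tt {d d' d'' : D} (q : B.Tensor d d') (r : B.Tensor d' d'') : B.Tensor d d'' :=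
  B.tlift (fun t s => B.tmk t (B.ut s r))
    (by
      intro c c' k t s
      induction r using B.tensor_ind with | h e t' s' =>
      simp only [ut, tlift, tmk, ← ul_ul, α_ul]
      exact B.tmk_ul k t _) q

section TensorLaws

variable {a b c e : A} {d d' d'' : D}

lemma ut_tmk (s : (B.U.obj d).obj (op c)) (t : (B.W.obj (op d)).obj e)
    (r : (B.U.obj d').obj (op e)) : B.ut s (B.tmk t r) = B.ul (B.α s t) r := rfl

lemma tw_tmk (t : (B.W.obj (op d)).obj e) (s : (B.U.obj d').obj (op e))
    (r : (B.W.obj (op d')).obj c) : B.tw (B.tmk t s) r = B.wr t (B.α s r) := rfl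

lemma dt_tmk (g : d ⟶ d') (t : (B.W.obj (op d')).obj e) (s : (B.U.obj d'').obj (op e)) :
    B.dt g (B.tmk t s) = B.tmk (B.wl g t) s := rfl

lemma td_tmk (t : (B.W.obj (op d)).obj e) (s : (B.U.obj d').obj (op e)) (g : d' ⟶ d'') :
    B.td (B.tmk t s) g = B.tmk t (B.ur s g) := rfl

lemma tt_tmk (t : (B.W.obj (op d)).obj e) (s : (B.U.obj d').obj (op e)) (q : B.Tensor d' d'') :
    B.tt (B.tmk t s) q = B.tmk t (B.ut s q) := rfl

end TensorLaws

/-- The objects of the collage of abstract bigluing data: the disjoint union of those of `A`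
and those of `D`. -/
inductive Collage (B : BigluingData A D) : Type u
  | old (c : A) : Collage B
  | new (d : D) : Collage B

namespace Collage

/-- The morphisms of the collage: `A(c, c')`, `U(c, d)`, `W(d, c)` and the disjoint union of
`D(d, d')` and `(U ⊗_A W)(d, d')`. -/
inductive Hom : B.Collage → B.Collage → Type u
  | oo {c c' : A} (f : c ⟶ c') : Hom (old c) (old c')
  | on {c : A} {d : D} (s : (B.U.obj d).obj (op c)) : Hom (old c) (new d)
  | no {d : D} {c : A} (t : (B.W.obj (op d)).obj c) : Hom (new d) (old c)
  | nn {d d' : D} (g : d ⟶ d') : Hom (new d) (new d')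
  | nt {d d' : D} (q : B.Tensor d d') : Hom (new d) (new d')

/-- Identities of the collage. -/
def id : ∀ x : B.Collage, Hom B x x
  | old c => .oo (𝟙 c)
  | new d => .nn (𝟙 d)

/-- Composition of the collage. -/
def comp : ∀ {x y z : B.Collage}, Hom B x y → Hom B y z → Hom B x z
  | _, _, _, .oo f, .oo g => .oo (f ≫ g)
  | _, _, _, .oo f, .on s => .on (B.ul f s)
  | _, _, _, .on s, .no t => .oo (B.α s t)
  | _, _, _, .on s, .nn g => .on (B.ur s g)
  | _, _, _, .on s, .nt q => .on (B.ut s q)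
  | _, _, _, .no t, .oo f => .no (B.wr t f)
  | _, _, _, .no t, .on s => .nt (B.tmk t s)
  | _, _, _, .nn g, .no t => .no (B.wl g t)
  | _, _, _, .nt q, .no t => .no (B.tw q t)
  | _, _, _, .nn f, .nn g => .nn (f ≫ g)
  | _, _, _, .nn f, .nt q => .nt (B.dt f q)
  | _, _, _, .nt q, .nn g => .nt (B.td q g)
  | _, _, _, .nt q, .nt r => .nt (B.tt q r)

end Collage

/-- The collage of abstract bigluing data. -/
instance : SmallCategory B.Collage where
  Hom := Collage.Hom B
  id := Collage.id B
  comp := Collage.comp B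
  id_comp := by
    rintro _ _ (f | s | t | g | q)
    · simp only [Collage.comp, Collage.id, Category.id_comp]
    · simp only [Collage.comp, Collage.id, ul_id]
    · simp only [Collage.comp, Collage.id, wl_id]
    · simp only [Collage.comp, Collage.id, Category.id_comp]
    · induction q using B.tensor_ind
      simp only [Collage.comp, Collage.id, dt_tmk, wl_id]
  comp_id := by
    rintro _ _ (f | s | t | g | q)
    · simp only [Collage.comp, Collage.id, Category.comp_id]
    · simp only [Collage.comp, Collage.id, ur_id]
    · simp only [Collage.comp, Collage.id, wr_id]
    · simp only [Collage.comp, Collage.id, Category.comp_id]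
    · induction q using B.tensor_ind
      simp only [Collage.comp, Collage.id, td_tmk, ur_id]
  assoc := by
    rintro _ _ _ _ (f | f | f | f | f) (g | g | g | g | g) (h | h | h | h | h) <;>
      (try induction f using B.tensor_ind) <;> (try induction g using B.tensor_ind) <;>
      (try induction h using B.tensor_ind) <;>
      simp only [Collage.comp, Category.assoc, ut_tmk, tw_tmk, dt_tmk, td_tmk, tt_tmk,
        ul_ul, ur_ur, ur_ul, wl_wl, wr_wr, wr_wl, α_ul, α_wr, α_ur, tmk_ul]

/-- The inclusion of `A` in the collage. -/
def inclOld : A ⥤ B.Collage where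
  obj c := .old c
  map f := Collage.Hom.oo f

end BigluingData

/-! ## Bistratified categories with discrete strata -/

section Bistratified

variable {C : Type u} [SmallCategory C] (deg : C → Ordinal.{v})

/-- The objects of degree `< δ`; they span the full subcategory `C_δ`. -/
def degLT (δ : Ordinal.{v}) : ObjectProperty C := fun x => deg x < δ

/-- The objects of degree `≤ δ`; they span the full subcategory `C_{δ+1}`. -/
def degLE (δ : Ordinal.{v}) : ObjectProperty C := fun x => deg x ≤ δ

lemma degLT_le_degLE (δ : Ordinal.{v}) : degLT deg δ ≤ degLE deg δ :=
  fun _ h => le_of_lt (α := Ordinal.{v}) h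

/-- `C` is bistratified with discrete strata, with degree function `deg`: it is obtained by
transfinitely iterating collages of abstract bigluing data whose target (the new stratum) is a
discrete category. That is, for every `δ` the inclusion `C_δ ⟶ C_{δ+1}` is, up to isomorphism of
categories under `C_δ`, the inclusion of `C_δ` in such a collage. (The full subcategories `C_δ`
start with the empty category, exhaust `C`, and `C_δ` is the union of the `C_δ'`, `δ' < δ`, when
`δ` is a limit ordinal, so nothing has to be required at limit stages.) -/
def IsBistratifiedDiscrete : Prop :=
  ∀ δ : Ordinal.{v}, ∃ (D : Type u) (_ : SmallCategory D)
    (B : BigluingData (degLT deg δ).FullSubcategory D)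
    (F : B.Collage ⥤ (degLE deg δ).FullSubcategory),
    IsDiscrete D ∧ Function.Bijective F.obj ∧ F.Full ∧ F.Faithful ∧
      B.inclOld ⋙ F = ObjectProperty.ιOfLE (degLT_le_degLE deg δ)

end Bistratified

/-! ## Weighted limits and colimits -/

noncomputable section Weighted

variable {K : Type u} [SmallCategory K] {M : Type*} [Category.{u} M]

/-- The `U`-weighted colimit functor `X ↦ U ⊗_K X`: the colimit of `X` over the pairs `(c, s)` with
`s : U(c)`, where a morphism `(c, s) ⟶ (c', s')` is `k : c ⟶ c'` with `U(k)(s') = s`. -/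
def weightedColim [HasColimits M] (U : Kᵒᵖ ⥤ Type u) : (K ⥤ M) ⥤ M :=
  (Functor.whiskeringLeft _ _ M).obj (CategoryOfElements.π U).leftOp ⋙ colim

/-- The `W`-weighted limit functor `X ↦ {W, X}_K`: the limit of `X` over the pairs `(c, t)` with
`t : W(c)`. -/
def weightedLim [HasLimits M] (W : K ⥤ Type u) : (K ⥤ M) ⥤ M :=
  (Functor.whiskeringLeft _ _ M).obj (CategoryOfElements.π W) ⋙ lim

section

variable [HasColimits M] {U : Kᵒᵖ ⥤ Type u} (X : K ⥤ M)

/-- The coprojection of the weighted colimit at `s : U(c)`. -/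
def weightedColimι {c : K} (s : U.obj (op c)) : X.obj c ⟶ (weightedColim U).obj X :=
  colimit.ι ((CategoryOfElements.π U).leftOp ⋙ X) (op (U.elementsMk (op c) s))

/-- Maps out of the weighted colimit. -/
def weightedColimDesc {Y : M} (φ : ∀ (c : K), U.obj (op c) → (X.obj c ⟶ Y))
    (h : ∀ {c c' : K} (k : c ⟶ c') (s : U.obj (op c')), X.map k ≫ φ c' s = φ c (U.map k.op s)) :
    (weightedColim U).obj X ⟶ Y :=
  colimit.desc ((CategoryOfElements.π U).leftOp ⋙ X)
    { pt := Y
      ι :=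
        { app := fun p => φ p.unop.1.unop p.unop.2
          naturality := fun p q k =>
            (h k.unop.1.unop q.unop.2).trans
              ((congrArg (φ p.unop.1.unop) k.unop.2).trans (Category.comp_id _).symm) } }

variable {X}

lemma weightedColimι_desc {Y : M} (φ : ∀ (c : K), U.obj (op c) → (X.obj c ⟶ Y))
    (h : ∀ {c c' : K} (k : c ⟶ c') (s : U.obj (op c')), X.map k ≫ φ c' s = φ c (U.map k.op s))
    {c : K} (s : U.obj (op c)) : weightedColimι X s ≫ weightedColimDesc X φ h = φ c s :=
  colimit.ι_desc _ _

lemma weightedColimι_map {X' : K ⥤ M} (f : X ⟶ X') {c : K} (s : U.obj (op c)) :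
    weightedColimι X s ≫ (weightedColim U).map f = f.app c ≫ weightedColimι X' s :=
  colimit.ι_map (Functor.whiskerLeft (CategoryOfElements.π U).leftOp f) _

lemma weightedColim_hom_ext {Y : M} {f g : (weightedColim U).obj X ⟶ Y}
    (h : ∀ (c : K) (s : U.obj (op c)), weightedColimι X s ≫ f = weightedColimι X s ≫ g) :
    f = g :=
  colimit.hom_ext (F := (CategoryOfElements.π U).leftOp ⋙ X) fun p => h p.unop.1.unop p.unop.2

end

section

variable [HasLimits M] {W : K ⥤ Type u} (X : K ⥤ M)

/-- The projection of the weighted limit at `t : W(c)`. -/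
def weightedLimπ {c : K} (t : W.obj c) : (weightedLim W).obj X ⟶ X.obj c :=
  limit.π (CategoryOfElements.π W ⋙ X) (W.elementsMk c t)

/-- Maps into the weighted limit. -/
def weightedLimLift {Y : M} (φ : ∀ (c : K), W.obj c → (Y ⟶ X.obj c))
    (h : ∀ {c c' : K} (k : c ⟶ c') (t : W.obj c), φ c t ≫ X.map k = φ c' (W.map k t)) :
    Y ⟶ (weightedLim W).obj X :=
  limit.lift (CategoryOfElements.π W ⋙ X)
    { pt := Y
      π :=
        { app := fun p => φ p.1 p.2
          naturality := fun p q k =>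
            (Category.id_comp _).trans
              ((congrArg (φ q.1) k.2).symm.trans (h k.1 p.2).symm) } }

variable {X}

lemma weightedLimLift_π {Y : M} (φ : ∀ (c : K), W.obj c → (Y ⟶ X.obj c))
    (h : ∀ {c c' : K} (k : c ⟶ c') (t : W.obj c), φ c t ≫ X.map k = φ c' (W.map k t))
    {c : K} (t : W.obj c) : weightedLimLift X φ h ≫ weightedLimπ X t = φ c t :=
  limit.lift_π _ _

lemma weightedLim_map_π {X' : K ⥤ M} (f : X ⟶ X') {c : K} (t : W.obj c) :
    (weightedLim W).map f ≫ weightedLimπ X' t = weightedLimπ X t ≫ f.app c :=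
  limMap_π (Functor.whiskerLeft (CategoryOfElements.π W) f) _

lemma weightedLim_hom_ext {Y : M} {f g : Y ⟶ (weightedLim W).obj X}
    (h : ∀ (c : K) (t : W.obj c), f ≫ weightedLimπ X t = g ≫ weightedLimπ X t) :
    f = g :=
  limit.hom_ext (F := CategoryOfElements.π W ⋙ X) fun p => h p.1 p.2

end

end Weighted

/-! ## Latching and matching objects, Reedy classes of maps -/

noncomputable section Reedy

variable {C : Type u} [SmallCategory C] (deg : C → Ordinal.{v}) {M : Type*} [Category.{u} M]

/-- The latching object functor `L_x A = C(-, x) ⊗ A`, over the objects of degree `< deg x`. -/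
def latching [HasColimits M] (x : C) : (C ⥤ M) ⥤ M :=
  (Functor.whiskeringLeft _ _ M).obj (degLT deg (deg x)).ι ⋙
    weightedColim ((degLT deg (deg x)).ι.op ⋙ yoneda.obj x)

/-- The canonical map `L_x A ⟶ A_x`, whose component at `f : c ⟶ x` is `A f`. -/
def latchingMap [HasColimits M] (x : C) : latching deg x ⟶ (evaluation C M).obj x where
  app A := weightedColimDesc (U := (degLT deg (deg x)).ι.op ⋙ yoneda.obj x)
    ((degLT deg (deg x)).ι ⋙ A) (fun c f => A.map (X := c.obj) (Y := x) f)
    (fun k f => (A.map_comp k.hom f).symm)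
  naturality A B f := by
    apply weightedColim_hom_ext
    intro c s
    dsimp only [latching, Functor.comp_map, Functor.whiskeringLeft_obj_map, evaluation_obj_map]
    erw [reassoc_of% (weightedColimι_map (U := (degLT deg (deg x)).ι.op ⋙ yoneda.obj x)
      ((degLT deg (deg x)).ι.whiskerLeft f) s), weightedColimι_desc,
      reassoc_of% (weightedColimι_desc (U := (degLT deg (deg x)).ι.op ⋙ yoneda.obj x)
        (X := (degLT deg (deg x)).ι ⋙ A))]
    exact (f.naturality (X := c.obj) (Y := x) s).symm

/-- The matching object functor `M_x A = {C(x, -), A}`, over the objects of degree `< deg x`. -/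
def matching [HasLimits M] (x : C) : (C ⥤ M) ⥤ M :=
  (Functor.whiskeringLeft _ _ M).obj (degLT deg (deg x)).ι ⋙
    weightedLim ((degLT deg (deg x)).ι ⋙ coyoneda.obj (op x))

/-- The canonical map `A_x ⟶ M_x A`, whose component at `f : x ⟶ c` is `A f`. -/
def matchingMap [HasLimits M] (x : C) : (evaluation C M).obj x ⟶ matching deg x where
  app A := weightedLimLift (W := (degLT deg (deg x)).ι ⋙ coyoneda.obj (op x))
    ((degLT deg (deg x)).ι ⋙ A) (fun c f => A.map (X := x) (Y := c.obj) f)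
    (fun k f => (A.map_comp f k.hom).symm)
  naturality A B f := by
    apply weightedLim_hom_ext
    intro c s
    dsimp only [matching, Functor.comp_map, Functor.whiskeringLeft_obj_map, evaluation_obj_map]
    rw [Category.assoc, Category.assoc]
    erw [weightedLim_map_π, weightedLimLift_π, reassoc_of% (weightedLimLift_π
      (W := (degLT deg (deg x)).ι ⋙ coyoneda.obj (op x)) (X := (degLT deg (deg x)).ι ⋙ A))]
    exact (f.naturality (X := x) (Y := c.obj) s).symm

/-- The relative latching map `L_x B ⊔_{L_x A} A_x ⟶ B_x` of `f : A ⟶ B`. -/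
def relLatchingMap [HasColimits M] {A B : C ⥤ M} (f : A ⟶ B) (x : C) :
    pushout ((latching deg x).map f) ((latchingMap deg x).app A) ⟶ B.obj x :=
  pushout.desc ((latchingMap deg x).app B) (f.app x) ((latchingMap deg x).naturality f)

/-- The relative matching map `A_x ⟶ M_x A ×_{M_x B} B_x` of `f : A ⟶ B`. -/
def relMatchingMap [HasLimits M] {A B : C ⥤ M} (f : A ⟶ B) (x : C) :
    A.obj x ⟶ pullback ((matching deg x).map f) ((matchingMap deg x).app B) :=
  pullback.lift ((matchingMap deg x).app A) (f.app x) ((matchingMap deg x).naturality f).symm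

/-- The left class of the Reedy weak factorization system on `C ⥤ M` induced by a weak
factorization system on `M` with left class `L`. -/
def reedyLeft [HasColimits M] (L : MorphismProperty M) : MorphismProperty (C ⥤ M) :=
  fun _ _ f => ∀ x, L (relLatchingMap deg f x)

/-- The right class of the Reedy weak factorization system on `C ⥤ M` induced by a weak
factorization system on `M` with right class `R`. -/
def reedyRight [HasLimits M] (R : MorphismProperty M) : MorphismProperty (C ⥤ M) :=
  fun _ _ f => ∀ x, R (relMatchingMap deg f x)

end Reedy

/-! ## Weak factorization systems and model structures -/

section Model

variable {E : Type*} [Category* E]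

/-- `X` is an `L`-object if `∅ ⟶ X` is an `L`-map. -/
def IsLeftObject [HasInitial E] (L : MorphismProperty E) (X : E) : Prop := L (initial.to X)

/-- The pairs of classes `(L₁, R₁)` and `(L₂, R₂)` are the two weak factorization systems
(acyclic cofibrations, fibrations) and (cofibrations, acyclic fibrations) of a model structure
with class of weak equivalences `we`. -/
structure FormModelStructure (L₁ R₁ L₂ R₂ we : MorphismProperty E) : Prop where
  wfs₁ : IsWeakFactorizationSystem L₁ R₁
  wfs₂ : IsWeakFactorizationSystem L₂ R₂
  left_eq : L₁ = L₂ ⊓ we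
  right_eq : R₂ = R₁ ⊓ we
  twoOutOfThree : we.HasTwoOutOfThreeProperty

/-- The maps all of whose pushouts are in `P`. (Mathlib's `MorphismProperty.universally` is the
dual notion, for pullbacks.) -/
def couniversally (P : MorphismProperty E) : MorphismProperty E := fun X Y f =>
  ∀ ⦃X' Y' : E⦄ (g : X ⟶ X') (g' : Y ⟶ Y') (f' : X' ⟶ Y'), IsPushout f g g' f' → P f'

end Model

/-- The injections: the left class of the weak factorization system (injections, surjections) on
the category of sets. -/
def injections : MorphismProperty (Type u) := fun _ _ f => Function.Injective f

/-
The functor `U ⊗ -` is left adjoint to the powers `X ↦ X ^ U`, and `{W, -}` is right adjoint to the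
copowers `K ↦ W · K`. The relative latching map of `W · i` at `x` is the pushout-product of `i` with
the latching map `λ : L_x W ⟶ W_x`, so it lifts against `p` if and only if `λ` lifts, in sets,
against the pullback-hom of `i` and `p`; dually for the relative matching maps of `p ^ U`. Hence
`{W, -}` takes Reedy acyclic fibrations to acyclic fibrations, which are universal weak
equivalences, if and only if every `λ` lifts against the pullback-homs of cofibrations and acyclic
fibrations. These are surjections, so it suffices that every `λ` is injective.

For the converse, consider the model structure on sets whose cofibrations are the injections and
whose weak equivalences are the maps between sets that are both empty or both nonempty. There, a
universal weak equivalence is surjective, hence an acyclic fibration, and the pullback-hom of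
`∅ ⟶ 1` and `{0, 1} ⟶ 1` is the map `{0, 1} ⟶ 1`, so that every `λ` is injective. The opposite
model category does the same for `U`.
-/

section Sets

lemma hasLiftingProperty_of_injective {A B X Y : Type u} (i : A ⟶ B) (p : X ⟶ Y)
    (hi : Function.Injective i) (hp : ∀ (_ : B) (_ : A → X), Function.Surjective p) :
    HasLiftingProperty i p := ⟨fun {f g} sq => by
  have w (a : A) : p (f a) = g (i a) := ConcreteCategory.congr_hom sq.w a
  have (b : B) : ∃ x : X, p x = g b ∧ ∀ a, i a = b → x = f a := by
    by_cases hb : ∃ a, i a = b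
    · obtain ⟨a, rfl⟩ := hb
      exact ⟨f a, w a, fun a' h => by rw [hi h]⟩
    · obtain ⟨x, hx⟩ := hp b f (g b)
      exact ⟨x, hx, fun a h => (hb ⟨a, h⟩).elim⟩
  choose l hl₁ hl₂ using this
  exact ⟨⟨{ l := ↾l
            fac_left := by ext a; exact hl₂ _ a rfl
            fac_right := by ext b; exact hl₁ b }⟩⟩⟩

lemma injective_of_hasLiftingProperty {A B S T : Type u} [Nontrivial S] [Subsingleton T]
    (i : A ⟶ B) (q : S ⟶ T) [HasLiftingProperty i q] : Function.Injective i := by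
  classical
  obtain ⟨s, s', hs⟩ := exists_pair_ne S
  intro a a' haa'
  by_contra hne
  let f : A ⟶ S := ↾fun b => if b = a then s else s'
  have sq : CommSq f i q (↾fun _ => q s) := ⟨by ext; exact Subsingleton.elim _ _⟩
  have hlift (b : A) : sq.lift (i b) = f b := ConcreteCategory.congr_hom sq.fac_left b
  have hff : f a = f a' := by rw [← hlift, ← hlift, haa']
  simp [f, Ne.symm hne, hs] at hff

end Sets

section PullbackHom

variable {M : Type*} [Category.{u} M]

/-- The pullback-hom of `i : K ⟶ L` and `p : X ⟶ Y`: the map from the set of morphisms `L ⟶ X`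
to the set of commutative squares from `i` to `p`. -/
noncomputable abbrev pullbackHom {K L X Y : M} (i : K ⟶ L) (p : X ⟶ Y) :
    (coyoneda.obj (op L)).obj X ⟶
      pullback ((coyoneda.obj (op K)).map p) ((coyoneda.map i.op).app Y) :=
  (Functor.PullbackObjObj.ofHasPullback coyoneda i p).π

lemma pullbackHom_surjective {K L X Y : M} (i : K ⟶ L) (p : X ⟶ Y) [HasLiftingProperty i p] :
    Function.Surjective (pullbackHom i p) := by
  intro z
  let S := Functor.PullbackObjObj.ofHasPullback coyoneda i p
  have sq : CommSq (S.fst z) i p (S.snd z) := ⟨ConcreteCategory.congr_hom S.isPullback.w z⟩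
  refine ⟨sq.lift, Types.ext_of_isPullback S.isPullback ?_ ?_⟩
  · exact (ConcreteCategory.congr_hom S.π_fst sq.lift).trans sq.fac_left
  · exact (ConcreteCategory.congr_hom S.π_snd sq.lift).trans sq.fac_right

lemma hasLiftingProperty_pullbackHom_of_injective {A B : Type u} {j : A ⟶ B}
    (hj : Function.Injective j) {K L X Y : M} (i : K ⟶ L) (p : X ⟶ Y) [HasLiftingProperty i p] :
    HasLiftingProperty j (pullbackHom i p) :=
  hasLiftingProperty_of_injective _ _ hj fun _ _ => pullbackHom_surjective i p

lemma injective_of_hasLiftingProperty_pullbackHom {A B : Type u} (j : A ⟶ B)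
    {K L X Y : M} (i : K ⟶ L) (p : X ⟶ Y)
    [Nontrivial (L ⟶ X)] [Subsingleton (K ⟶ X)] [Subsingleton (L ⟶ Y)]
    [HasLiftingProperty j (pullbackHom i p)] : Function.Injective j := by
  let S := Functor.PullbackObjObj.ofHasPullback coyoneda i p
  have : Subsingleton S.pt := ⟨fun z z' => Types.ext_of_isPullback S.isPullback
    (Subsingleton.elim (α := K ⟶ X) _ _) (Subsingleton.elim (α := L ⟶ Y) _ _)⟩
  have : Nontrivial ((coyoneda.obj (op L)).obj X) := inferInstanceAs (Nontrivial (L ⟶ X))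
  have : HasLiftingProperty j S.π := ‹HasLiftingProperty j (pullbackHom i p)›
  exact injective_of_hasLiftingProperty j S.π

end PullbackHom

noncomputable section Latching

variable {K : Type u} [SmallCategory K] {M : Type*} [Category.{u} M]

lemma map_weightedColimι [HasColimits M] {U : Kᵒᵖ ⥤ Type u} (X : K ⥤ M) {c c' : K} (k : c ⟶ c')
    (s : U.obj (op c')) :
    X.map k ≫ weightedColimι X s = weightedColimι X (U.map k.op s) :=
  colimit.w ((CategoryOfElements.π U).leftOp ⋙ X)
    (Quiver.Hom.op (CategoryOfElements.homMk (U.elementsMk (op c') s)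
      (U.elementsMk (op c) (U.map k.op s)) k.op rfl))

lemma weightedLimπ_map [HasLimits M] {W : K ⥤ Type u} (X : K ⥤ M) {c c' : K} (k : c ⟶ c')
    (t : W.obj c) :
    weightedLimπ X t ≫ X.map k = weightedLimπ X (W.map k t) :=
  limit.w (CategoryOfElements.π W ⋙ X)
    (CategoryOfElements.homMk (W.elementsMk c t) (W.elementsMk c' (W.map k t)) k rfl)

variable {C : Type u} [SmallCategory C] {deg : C → Ordinal.{v}}

section Colim

variable [HasColimits M] (A : C ⥤ M) {x : C}

/-- The coprojection of the latching object `L_x A` at `f : c ⟶ x`. -/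
def latchingι {c : C} (hc : deg c < deg x) (f : c ⟶ x) :
    A.obj c ⟶ (latching deg x).obj A :=
  weightedColimι (U := (degLT deg (deg x)).ι.op ⋙ yoneda.obj x)
    ((degLT deg (deg x)).ι ⋙ A) (c := ⟨c, hc⟩) f

/-- Maps out of the latching object. -/
def latchingDesc {Y : M} (φ : ∀ c : C, deg c < deg x → (c ⟶ x) → (A.obj c ⟶ Y))
    (h : ∀ (c c' : C) (hc : deg c < deg x) (hc' : deg c' < deg x) (k : c ⟶ c') (f : c' ⟶ x),
      A.map k ≫ φ c' hc' f = φ c hc (k ≫ f)) :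
    (latching deg x).obj A ⟶ Y :=
  weightedColimDesc (U := (degLT deg (deg x)).ι.op ⋙ yoneda.obj x)
    ((degLT deg (deg x)).ι ⋙ A) (fun c f => φ c.obj c.property f) (fun k f => h _ _ _ _ k.hom f)

variable {A}

lemma latchingι_desc {Y : M} (φ : ∀ c : C, deg c < deg x → (c ⟶ x) → (A.obj c ⟶ Y))
    (h : ∀ (c c' : C) (hc : deg c < deg x) (hc' : deg c' < deg x) (k : c ⟶ c') (f : c' ⟶ x),
      A.map k ≫ φ c' hc' f = φ c hc (k ≫ f)) {c : C} (hc : deg c < deg x) (f : c ⟶ x) :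
    latchingι A hc f ≫ latchingDesc A φ h = φ c hc f :=
  weightedColimι_desc (U := (degLT deg (deg x)).ι.op ⋙ yoneda.obj x)
    (X := (degLT deg (deg x)).ι ⋙ A) (fun c f => φ c.obj c.property f)
    (fun k f => h _ _ _ _ k.hom f) (c := ⟨c, hc⟩) f

lemma latchingι_latchingMap {c : C} (hc : deg c < deg x) (f : c ⟶ x) :
    latchingι A hc f ≫ (latchingMap deg x).app A = A.map f :=
  latchingι_desc (fun _ _ f => A.map f) (fun _ _ _ _ k f => (A.map_comp k f).symm) hc f

lemma latchingι_map {B : C ⥤ M} (g : A ⟶ B) {c : C} (hc : deg c < deg x) (f : c ⟶ x) :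
    latchingι A hc f ≫ (latching deg x).map g = g.app c ≫ latchingι B hc f :=
  weightedColimι_map (U := (degLT deg (deg x)).ι.op ⋙ yoneda.obj x)
    (X := (degLT deg (deg x)).ι ⋙ A) ((degLT deg (deg x)).ι.whiskerLeft g) (c := ⟨c, hc⟩) f

lemma map_latchingι {c c' : C} (hc : deg c < deg x) (hc' : deg c' < deg x) (k : c ⟶ c')
    (f : c' ⟶ x) : A.map k ≫ latchingι A hc' f = latchingι A hc (k ≫ f) :=
  map_weightedColimι (U := (degLT deg (deg x)).ι.op ⋙ yoneda.obj x)
    ((degLT deg (deg x)).ι ⋙ A) (c := ⟨c, hc⟩) (c' := ⟨c', hc'⟩) ⟨k⟩ f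

lemma latching_hom_ext {Y : M} {g g' : (latching deg x).obj A ⟶ Y}
    (h : ∀ (c : C) (hc : deg c < deg x) (f : c ⟶ x),
      latchingι A hc f ≫ g = latchingι A hc f ≫ g') : g = g' :=
  weightedColim_hom_ext (U := (degLT deg (deg x)).ι.op ⋙ yoneda.obj x)
    (X := (degLT deg (deg x)).ι ⋙ A) fun c f => h c.obj c.property f

end Colim

section Lim

variable [HasLimits M] (A : C ⥤ M) {x : C}

/-- The projection of the matching object `M_x A` at `f : x ⟶ c`. -/
def matchingπ {c : C} (hc : deg c < deg x) (f : x ⟶ c) :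
    (matching deg x).obj A ⟶ A.obj c :=
  weightedLimπ (W := (degLT deg (deg x)).ι ⋙ coyoneda.obj (op x))
    ((degLT deg (deg x)).ι ⋙ A) (c := ⟨c, hc⟩) f

/-- Maps into the matching object. -/
def matchingLift {Y : M} (φ : ∀ c : C, deg c < deg x → (x ⟶ c) → (Y ⟶ A.obj c))
    (h : ∀ (c c' : C) (hc : deg c < deg x) (hc' : deg c' < deg x) (k : c ⟶ c') (f : x ⟶ c),
      φ c hc f ≫ A.map k = φ c' hc' (f ≫ k)) :
    Y ⟶ (matching deg x).obj A :=
  weightedLimLift (W := (degLT deg (deg x)).ι ⋙ coyoneda.obj (op x))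
    ((degLT deg (deg x)).ι ⋙ A) (fun c f => φ c.obj c.property f) (fun k f => h _ _ _ _ k.hom f)

variable {A}

lemma matchingLift_π {Y : M} (φ : ∀ c : C, deg c < deg x → (x ⟶ c) → (Y ⟶ A.obj c))
    (h : ∀ (c c' : C) (hc : deg c < deg x) (hc' : deg c' < deg x) (k : c ⟶ c') (f : x ⟶ c),
      φ c hc f ≫ A.map k = φ c' hc' (f ≫ k)) {c : C} (hc : deg c < deg x) (f : x ⟶ c) :
    matchingLift A φ h ≫ matchingπ A hc f = φ c hc f :=
  weightedLimLift_π (W := (degLT deg (deg x)).ι ⋙ coyoneda.obj (op x))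
    (X := (degLT deg (deg x)).ι ⋙ A) (fun c f => φ c.obj c.property f)
    (fun k f => h _ _ _ _ k.hom f) (c := ⟨c, hc⟩) f

lemma matchingMap_matchingπ {c : C} (hc : deg c < deg x) (f : x ⟶ c) :
    (matchingMap deg x).app A ≫ matchingπ A hc f = A.map f :=
  matchingLift_π (fun _ _ f => A.map f) (fun _ _ _ _ k f => (A.map_comp f k).symm) hc f

lemma matching_map_π {B : C ⥤ M} (g : A ⟶ B) {c : C} (hc : deg c < deg x) (f : x ⟶ c) :
    (matching deg x).map g ≫ matchingπ B hc f = matchingπ A hc f ≫ g.app c :=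
  weightedLim_map_π (W := (degLT deg (deg x)).ι ⋙ coyoneda.obj (op x))
    (X := (degLT deg (deg x)).ι ⋙ A) ((degLT deg (deg x)).ι.whiskerLeft g) (c := ⟨c, hc⟩) f

lemma matchingπ_map {c c' : C} (hc : deg c < deg x) (hc' : deg c' < deg x) (k : c ⟶ c')
    (f : x ⟶ c) : matchingπ A hc f ≫ A.map k = matchingπ A hc' (f ≫ k) :=
  weightedLimπ_map (W := (degLT deg (deg x)).ι ⋙ coyoneda.obj (op x))
    ((degLT deg (deg x)).ι ⋙ A) (c := ⟨c, hc⟩) (c' := ⟨c', hc'⟩) ⟨k⟩ f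

lemma matching_hom_ext {Y : M} {g g' : Y ⟶ (matching deg x).obj A}
    (h : ∀ (c : C) (hc : deg c < deg x) (f : x ⟶ c),
      g ≫ matchingπ A hc f = g' ≫ matchingπ A hc f) : g = g' :=
  weightedLim_hom_ext (W := (degLT deg (deg x)).ι ⋙ coyoneda.obj (op x))
    (X := (degLT deg (deg x)).ι ⋙ A) fun c f => h c.obj c.property f

end Lim

end Latching

noncomputable section Copowers

variable {C : Type u} [SmallCategory C] {M : Type*} [Category.{u} M]

/-- The two-variable adjunction `M(S · K, X) ≃ Set(S, M(K, X))` between copowers and hom-sets. -/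
def sigmaConstParamAdj [HasColimits M] :
    (sigmaConst : M ⥤ Type u ⥤ M) ⊣₂ (coyoneda : Mᵒᵖ ⥤ M ⥤ Type u) where
  adj := sigmaConstAdj
  unit_whiskerRight_map f := by ext; simp [sigmaConstAdj]

/-- The two-variable adjunction `M(S · K, X) ≃ M(K, X ^ S)` between copowers and powers. -/
def sigmaConstFlipAdj [HasColimits M] [HasLimits M] :
    (sigmaConst : M ⥤ Type u ⥤ M).flip ⊣₂ (piConst : M ⥤ (Type u)ᵒᵖ ⥤ M).flip where
  adj S := Adjunction.mkOfHomEquiv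
    { homEquiv := fun K X =>
        { toFun g := Pi.lift fun s => Sigma.ι (fun _ => K) s ≫ g
          invFun g := Sigma.desc fun s => g ≫ Pi.π (fun _ => X) s
          left_inv g := Sigma.hom_ext _ _ fun s => by simp
          right_inv g := Pi.hom_ext _ _ fun s => by simp }
      homEquiv_naturality_left_symm _ _ := Sigma.hom_ext _ _ fun s => by simp
      homEquiv_naturality_right _ _ := Pi.hom_ext _ _ fun s => by simp }
  unit_whiskerRight_map f := by
    ext K
    exact Pi.hom_ext _ _ fun s => by simp

section

variable [HasColimits M] (W : C ⥤ Type u)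

/-- The copowers functor `K ↦ W · K`, where `(W · K)(c)` is the coproduct of `W(c)` copies
of `K`. -/
abbrev copowers : M ⥤ C ⥤ M := sigmaConst ⋙ (Functor.whiskeringLeft C (Type u) M).obj W

variable {W} in
lemma ι_copowers_app_map {K : M} {A : C ⥤ M} (g : (copowers W).obj K ⟶ A) {c c' : C} (k : c ⟶ c')
    (t : W.obj c) :
    (Sigma.ι (fun _ => K) t ≫ g.app c) ≫ A.map k = Sigma.ι (fun _ => K) (W.map k t) ≫ g.app c' := by
  simp [← g.naturality]

/-- Maps out of the copowers `W · K` are maps from `K` into the `W`-weighted limit. -/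
def copowersAdj [HasLimits M] : copowers (M := M) W ⊣ weightedLim W :=
  Adjunction.mkOfHomEquiv
    { homEquiv K A :=
        { toFun g := weightedLimLift A (fun _ t => Sigma.ι (fun _ => K) t ≫ g.app _)
            (ι_copowers_app_map g)
          invFun g :=
            { app c := Sigma.desc fun t => g ≫ weightedLimπ A t
              naturality c c' k := Sigma.hom_ext _ _ fun t => by simp [weightedLimπ_map] }
          left_inv g := by
            ext c
            exact Sigma.hom_ext _ _ fun t => by simp [weightedLimLift_π]
          right_inv g := weightedLim_hom_ext fun c t => (weightedLimLift_π _ _ t).trans (by simp) }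
      homEquiv_naturality_left_symm f g := by
        ext c
        exact Sigma.hom_ext _ _ fun t => by simp
      homEquiv_naturality_right f g := weightedLim_hom_ext fun c t =>
        (weightedLimLift_π _ (ι_copowers_app_map (f ≫ g)) t).trans (by
          simp [weightedLim_map_π, reassoc_of% weightedLimLift_π]) }

end

section

variable [HasLimits M] (U : Cᵒᵖ ⥤ Type u)

/-- The powers functor `X ↦ X ^ U`, where `(X ^ U)(c)` is the product of `U(c)` copies of `X`. -/
abbrev powers : M ⥤ C ⥤ M := piConst ⋙ (Functor.whiskeringLeft C (Type u)ᵒᵖ M).obj U.rightOp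

/-- Maps into the powers `X ^ U` are maps out of the `U`-weighted colimit into `X`. -/
def powersAdj [HasColimits M] : weightedColim U ⊣ powers (M := M) U :=
  Adjunction.mkOfHomEquiv
    { homEquiv A X :=
        { toFun g :=
            { app c := Pi.lift fun s => weightedColimι A s ≫ g
              naturality c c' k := Pi.hom_ext _ _ fun s => by
                simp [reassoc_of% map_weightedColimι] }
          invFun g := weightedColimDesc A (fun c s => g.app c ≫ Pi.π (fun _ => X) s)
            fun k s => by simp [reassoc_of% g.naturality]
          left_inv g := weightedColim_hom_ext fun c s =>
            (weightedColimι_desc _ _ s).trans (by simp)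
          right_inv g := by
            ext c
            exact Pi.hom_ext _ _ fun s => by simp [weightedColimι_desc] }
      homEquiv_naturality_left_symm f g := weightedColim_hom_ext fun c s => by
        simp [weightedColimι_desc, reassoc_of% weightedColimι_map]
      homEquiv_naturality_right f g := by
        ext c
        exact Pi.hom_ext _ _ fun s => by simp }

end

end Copowers

noncomputable section PushoutProduct

variable {C : Type u} [SmallCategory C] {deg : C → Ordinal.{v}} {M : Type*} [Category.{u} M]

section

variable [HasColimits M]

lemma sigma_latching_hom_ext {W : C ⥤ Type u} {x : C} {K Y : M}
    {g g' : (∐ fun _ : (latching deg x).obj W => K) ⟶ Y}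
    (h : ∀ (c : C) (hc : deg c < deg x) (f : c ⟶ x) (t : W.obj c),
      Sigma.ι (fun _ => K) (latchingι W hc f t) ≫ g =
        Sigma.ι (fun _ => K) (latchingι W hc f t) ≫ g') : g = g' := by
  have : (↾fun z => Sigma.ι (fun _ => K) z ≫ g) = ↾fun z => Sigma.ι (fun _ => K) z ≫ g' :=
    latching_hom_ext fun c hc f => by
      ext t
      exact h c hc f t
  exact Sigma.hom_ext _ _ (ConcreteCategory.congr_hom this)

/-- Copowers commute with latching objects: the coproduct of `L_x W` copies of `K` is
`L_x (W · K)`. -/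
def sigmaLatchingIso (W : C ⥤ Type u) (x : C) (K : M) :
    (∐ fun _ : (latching deg x).obj W => K) ≅ (latching deg x).obj ((copowers W).obj K) where
  hom := Sigma.desc (latchingDesc W
    (fun c hc f => ↾fun t => Sigma.ι (fun _ : W.obj c => K) t ≫
      latchingι ((copowers W).obj K) hc f)
    fun c c' hc hc' k f => by
      ext t
      simp [← map_latchingι hc hc'])
  inv := latchingDesc _
    (fun c hc f => Sigma.desc fun t => Sigma.ι (fun _ => K) (latchingι W hc f t))
    fun c c' hc hc' k f => Sigma.hom_ext _ _ fun t => by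
      simp [← map_latchingι hc hc']
  hom_inv_id := sigma_latching_hom_ext fun c hc f t => by
    rw [Limits.Sigma.ι_desc_assoc, ← ConcreteCategory.comp_apply, latchingι_desc]
    simp [latchingι_desc]
  inv_hom_id := latching_hom_ext fun c hc f => Sigma.hom_ext _ _ fun t => by
    rw [reassoc_of% latchingι_desc, Limits.Sigma.ι_desc_assoc, Limits.Sigma.ι_desc,
      ← ConcreteCategory.comp_apply, latchingι_desc]
    simp

lemma ι_sigmaLatchingIso_hom (W : C ⥤ Type u) {x : C} (K : M) {c : C} (hc : deg c < deg x)
    (f : c ⟶ x) (t : W.obj c) :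
    Sigma.ι (fun _ => K) (latchingι W hc f t) ≫ (sigmaLatchingIso W x K).hom =
      Sigma.ι (fun _ : W.obj c => K) t ≫ latchingι ((copowers W).obj K) hc f := by
  rw [sigmaLatchingIso, Limits.Sigma.ι_desc, ← ConcreteCategory.comp_apply, latchingι_desc]
  rfl

lemma sigmaLatchingIso_hom_naturality (W : C ⥤ Type u) (x : C) {K L : M} (i : K ⟶ L) :
    (sigmaLatchingIso W x K).hom ≫ (latching deg x).map ((copowers W).map i) =
      (sigmaConst.map i).app ((latching deg x).obj W) ≫ (sigmaLatchingIso W x L).hom :=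
  sigma_latching_hom_ext fun c hc f t => by
    rw [← Category.assoc, ι_sigmaLatchingIso_hom, Category.assoc, latchingι_map]
    simp [ι_sigmaLatchingIso_hom]

lemma sigmaLatchingIso_hom_latchingMap (W : C ⥤ Type u) (x : C) (K : M) :
    (sigmaLatchingIso W x K).hom ≫ (latchingMap deg x).app ((copowers W).obj K) =
      (sigmaConst.obj K).map ((latchingMap deg x).app W) :=
  sigma_latching_hom_ext fun c hc f t => by
    rw [← Category.assoc, ι_sigmaLatchingIso_hom, Category.assoc, latchingι_latchingMap]
    simp [← latchingι_latchingMap (A := W) hc f]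

/-- The relative latching map of `W · K ⟶ W · L` at `x` is the pushout-product of `i : K ⟶ L`
with the latching map `L_x W ⟶ W_x`. -/
def relLatchingPushoutObjObj (deg : C → Ordinal.{v}) (W : C ⥤ Type u) (x : C) {K L : M}
    (i : K ⟶ L) :
    sigmaConst.PushoutObjObj i ((latchingMap deg x).app W) where
  pt := pushout ((latching deg x).map ((copowers W).map i))
    ((latchingMap deg x).app ((copowers W).obj K))
  inl := (sigmaLatchingIso W x L).hom ≫ pushout.inl _ _
  inr := pushout.inr _ _
  isPushout := (IsPushout.of_hasPushout _ _).of_iso (sigmaLatchingIso W x K).symm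
    (sigmaLatchingIso W x L).symm (Iso.refl _) (Iso.refl _)
    (by
      rw [Iso.symm_hom, Iso.symm_hom, Iso.eq_inv_comp, ← Category.assoc, Iso.comp_inv_eq]
      exact sigmaLatchingIso_hom_naturality W x i)
    (by
      rw [Iso.symm_hom, Iso.refl_hom, Category.comp_id, Iso.eq_inv_comp]
      exact sigmaLatchingIso_hom_latchingMap W x K)
    (by simp) (by simp)
  ι := relLatchingMap deg ((copowers W).map i) x
  inl_ι := by
    rw [Category.assoc, relLatchingMap, pushout.inl_desc]
    exact sigmaLatchingIso_hom_latchingMap W x L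
  inr_ι := pushout.inr_desc _ _ _

end

section

variable [HasLimits M]

lemma pi_latching_hom_ext {W : C ⥤ Type u} {x : C} {X Y : M}
    {g g' : X ⟶ ∏ᶜ fun _ : (latching deg x).obj W => Y}
    (h : ∀ (c : C) (hc : deg c < deg x) (f : c ⟶ x) (t : W.obj c),
      g ≫ Pi.π (fun _ => Y) (latchingι W hc f t) = g' ≫ Pi.π (fun _ => Y) (latchingι W hc f t)) :
    g = g' := by
  have : (↾fun z => g ≫ Pi.π (fun _ => Y) z) = ↾fun z => g' ≫ Pi.π (fun _ => Y) z :=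
    latching_hom_ext fun c hc f => by
      ext t
      exact h c hc f t
  exact Pi.hom_ext _ _ (ConcreteCategory.congr_hom this)

/-- Powers turn latching objects into matching objects: `M_x (X ^ U)` is the product of `L_x U`
copies of `X`. -/
def matchingPiIso (U : Cᵒᵖ ⥤ Type u) (x : C) (X : M) :
    (matching deg x).obj ((powers U).obj X) ≅
      ∏ᶜ fun _ : (latching (fun x : Cᵒᵖ => deg x.unop) (op x)).obj U => X where
  hom := Pi.lift (latchingDesc U
    (fun c hc f => ↾fun s => matchingπ ((powers U).obj X) hc f.unop ≫
      Pi.π (fun _ : U.obj c => X) s)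
    fun c c' hc hc' k f => by
      ext t
      simp [← matchingπ_map hc' hc])
  inv := matchingLift _
    (fun c hc f => Pi.lift fun s => Pi.π (fun _ => X)
      (latchingι (deg := fun x : Cᵒᵖ => deg x.unop) U (c := op c) hc f.op s))
    fun c c' hc hc' k f => Pi.hom_ext _ _ fun t => by
      simp [← map_latchingι (deg := fun x : Cᵒᵖ => deg x.unop) (c := op c') (c' := op c) hc' hc]
  hom_inv_id := matching_hom_ext fun c hc f => Pi.hom_ext _ _ fun s => by
    simp only [Category.assoc, reassoc_of% matchingLift_π, Limits.Pi.lift_π]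
    rw [← ConcreteCategory.comp_apply, latchingι_desc]
    simp
  inv_hom_id := pi_latching_hom_ext fun c hc f s => by
    rw [Category.assoc, Limits.Pi.lift_π, ← ConcreteCategory.comp_apply, latchingι_desc]
    simp [reassoc_of% matchingLift_π]

lemma matchingPiIso_hom_π (U : Cᵒᵖ ⥤ Type u) {x : C} (X : M) {c : Cᵒᵖ} (hc : deg c.unop < deg x)
    (f : c ⟶ op x) (s : U.obj c) :
    (matchingPiIso U x X).hom ≫ Pi.π (fun _ => X)
        (latchingι (deg := fun x : Cᵒᵖ => deg x.unop) U hc f s) =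
      matchingπ ((powers U).obj X) hc f.unop ≫ Pi.π (fun _ : U.obj c => X) s := by
  rw [matchingPiIso, Limits.Pi.lift_π, ← ConcreteCategory.comp_apply, latchingι_desc]
  rfl

lemma matchingPiIso_hom_naturality (U : Cᵒᵖ ⥤ Type u) (x : C) {X Y : M} (p : X ⟶ Y) :
    (matching deg x).map ((powers U).map p) ≫ (matchingPiIso U x Y).hom =
      (matchingPiIso U x X).hom ≫ Limits.Pi.map fun _ => p :=
  pi_latching_hom_ext fun c hc f s => by
    rw [Category.assoc, matchingPiIso_hom_π, ← Category.assoc, matching_map_π]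
    simp [reassoc_of% matchingPiIso_hom_π]

lemma matchingMap_matchingPiIso_hom (U : Cᵒᵖ ⥤ Type u) (x : C) (X : M) :
    (matchingMap deg x).app ((powers U).obj X) ≫ (matchingPiIso U x X).hom =
      (piConst.obj X).map ((latchingMap (fun x : Cᵒᵖ => deg x.unop) (op x)).app U).op :=
  pi_latching_hom_ext fun c hc f s => by
    rw [Category.assoc, matchingPiIso_hom_π, ← Category.assoc, matchingMap_matchingπ]
    simp [← latchingι_latchingMap (deg := fun x : Cᵒᵖ => deg x.unop) (x := op x) hc]

/-- The relative matching map of `X ^ U ⟶ Y ^ U` at `x` is the pullback-power of `p : X ⟶ Y` by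
the latching map `L_x U ⟶ U_x`. -/
def relMatchingPullbackObjObj (deg : C → Ordinal.{v}) (U : Cᵒᵖ ⥤ Type u) (x : C) {X Y : M}
    (p : X ⟶ Y) : (piConst (C := M)).flip.PullbackObjObj
      ((latchingMap (fun x : Cᵒᵖ => deg x.unop) (op x)).app U) p where
  pt := pullback ((matching deg x).map ((powers U).map p))
    ((matchingMap deg x).app ((powers U).obj Y))
  fst := pullback.fst _ _ ≫ (matchingPiIso U x X).hom
  snd := pullback.snd _ _
  isPullback := (IsPullback.of_hasPullback _ _).of_iso (Iso.refl _) (matchingPiIso U x X)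
    (Iso.refl _) (matchingPiIso U x Y) (by simp) (by simp) (matchingPiIso_hom_naturality U x p)
    (by
      rw [Iso.refl_hom, Category.id_comp]
      exact matchingMap_matchingPiIso_hom U x Y)
  π := relMatchingMap deg ((powers U).map p) x
  π_fst := by
    rw [← Category.assoc, relMatchingMap, pullback.lift_fst]
    exact matchingMap_matchingPiIso_hom U x X
  π_snd := pullback.lift_snd _ _ _

end

end PushoutProduct

section WeakFactorizationSystem

lemma left_le_inverseImage_iff_right_le_inverseImage {D E : Type*} [Category* D] [Category* E]
    {F : D ⥤ E} {G : E ⥤ D} (adj : F ⊣ G) (L R : MorphismProperty D)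
    (L' R' : MorphismProperty E) [IsWeakFactorizationSystem L R]
    [IsWeakFactorizationSystem L' R'] : L ≤ L'.inverseImage F ↔ R' ≤ R.inverseImage G := by
  rw [← llp_eq_of_wfs L' R', ← rlp_eq_of_wfs L R]
  exact ⟨fun h _ _ p hp _ _ i hi => (adj.hasLiftingProperty_iff i p).1 (h i hi p hp),
    fun h _ _ i hi _ _ p hp => (adj.hasLiftingProperty_iff i p).2 (h p hp i hi)⟩

variable {C : Type u} [SmallCategory C] (deg : C → Ordinal.{v}) {M : Type*} [Category.{u} M]
  [HasColimits M]

lemma hasLiftingProperty_relLatchingMap_copowers_iff (W : C ⥤ Type u) (x : C) {K L X Y : M}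
    (i : K ⟶ L) (p : X ⟶ Y) :
    HasLiftingProperty (relLatchingMap deg ((copowers W).map i) x) p ↔
      HasLiftingProperty ((latchingMap deg x).app W) (pullbackHom i p) :=
  sigmaConstParamAdj.hasLiftingProperty_iff (relLatchingPushoutObjObj deg W x i)
    (.ofHasPullback coyoneda i p)

variable [HasLimits M]

lemma hasLiftingProperty_relMatchingMap_powers_iff (U : Cᵒᵖ ⥤ Type u) (x : C) {K L X Y : M}
    (i : K ⟶ L) (p : X ⟶ Y) :
    HasLiftingProperty i (relMatchingMap deg ((powers U).map p) x) ↔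
      HasLiftingProperty ((latchingMap (fun x : Cᵒᵖ => deg x.unop) (op x)).app U)
        (pullbackHom i p) := by
  let sq := Functor.PushoutObjObj.ofHasPushout sigmaConst i
    ((latchingMap (fun x : Cᵒᵖ => deg x.unop) (op x)).app U)
  exact (sigmaConstFlipAdj.hasLiftingProperty_iff sq.flip
    (relMatchingPullbackObjObj deg U x p)).symm.trans
      (sigmaConstParamAdj.hasLiftingProperty_iff sq (.ofHasPullback coyoneda i p))

variable (L R : MorphismProperty M) [IsWeakFactorizationSystem L R]
  [IsWeakFactorizationSystem (reedyLeft deg L) (reedyRight (C := C) deg R)]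

theorem reedyLeft_le_inverseImage_weightedColim_iff (U : Cᵒᵖ ⥤ Type u) :
    reedyLeft deg L ≤ L.inverseImage (weightedColim U) ↔
      ∀ (x : Cᵒᵖ) ⦃A B X Y : M⦄ (i : A ⟶ B) (p : X ⟶ Y), L i → R p →
        HasLiftingProperty ((latchingMap (fun x : Cᵒᵖ => deg x.unop) x).app U)
          (pullbackHom i p) := by
  rw [left_le_inverseImage_iff_right_le_inverseImage (powersAdj U) _ (reedyRight deg R) L R]
  calc
    R ≤ (reedyRight deg R).inverseImage (powers U)
    _ ↔ ∀ ⦃X Y : M⦄ (p : X ⟶ Y), R p → ∀ (x : C) ⦃A B : M⦄ (i : A ⟶ B), L i →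
          HasLiftingProperty i (relMatchingMap deg ((powers U).map p) x) := by
      simp only [← rlp_eq_of_wfs L R]; rfl
    _ ↔ _ := by
      simp only [hasLiftingProperty_relMatchingMap_powers_iff]
      exact ⟨fun h x _ _ _ _ i p hi hp => h p hp x.unop i hi,
        fun h _ _ p hp x _ _ i hi => h (op x) i p hi hp⟩

theorem reedyRight_le_inverseImage_weightedLim_iff (W : C ⥤ Type u) :
    reedyRight deg R ≤ R.inverseImage (weightedLim W) ↔
      ∀ (x : C) ⦃A B X Y : M⦄ (i : A ⟶ B) (p : X ⟶ Y), L i → R p →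
        HasLiftingProperty ((latchingMap deg x).app W) (pullbackHom i p) := by
  rw [← left_le_inverseImage_iff_right_le_inverseImage (copowersAdj W) L R (reedyLeft deg L) _]
  calc
    L ≤ (reedyLeft deg L).inverseImage (copowers W)
    _ ↔ ∀ ⦃A B : M⦄ (i : A ⟶ B), L i → ∀ (x : C) ⦃X Y : M⦄ (p : X ⟶ Y), R p →
          HasLiftingProperty (relLatchingMap deg ((copowers W).map i) x) p := by
      simp only [← llp_eq_of_wfs L R]; rfl
    _ ↔ _ := by
      simp only [hasLiftingProperty_relLatchingMap_copowers_iff]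
      exact ⟨fun h x _ _ _ _ i p hi hp => h i hi x p hp,
        fun h _ _ i hi x _ _ p hp => h x i p hi hp⟩

end WeakFactorizationSystem

section LeftObject

variable {C : Type u} [SmallCategory C] {deg : C → Ordinal.{v}} {M : Type*} [Category.{u} M]
  [HasColimits M]

lemma isIso_latchingMap_of_isInitial {A : C ⥤ M} (hA : IsInitial A) (x : C) :
    IsIso ((latchingMap deg x).app A) := by
  have hobj (c : C) : IsInitial (A.obj c) := hA.isInitialObj ((evaluation C M).obj c)
  exact ⟨(hobj x).to _, latching_hom_ext fun c _ _ => (hobj c).hom_ext _ _,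
    (hobj x).hom_ext _ _⟩

lemma isLeftObject_reedyLeft_iff (L : MorphismProperty M) [L.RespectsIso] (A : C ⥤ M) :
    IsLeftObject (reedyLeft deg L) A ↔ ∀ x, L ((latchingMap deg x).app A) := by
  refine forall_congr' fun x => ?_
  have := isIso_latchingMap_of_isInitial (deg := deg) (initialIsInitial (C := C ⥤ M)) x
  rw [← L.cancel_left_of_respectsIso (pushout.inl _ _), relLatchingMap, pushout.inl_desc]

end LeftObject

section Nonemptiness

lemma injections_eq_monomorphisms : injections.{u} = monomorphisms (Type u) := by
  ext X Y f
  exact (mono_iff_injective f).symm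

instance : injections.{u}.RespectsIso := by
  rw [injections_eq_monomorphisms]
  infer_instance

/-- The model structure on the category of sets in which the cofibrations are the injections and a
map is a weak equivalence if its source and its target are both empty or both nonempty. The acyclic
fibrations are the surjections. -/
@[reducible]
def nonemptinessModelCategory : ModelCategory (Type u) where
  categoryWithFibrations := ⟨fun X _ p => Nonempty X → Function.Surjective p⟩
  categoryWithCofibrations := ⟨injections⟩
  categoryWithWeakEquivalences := ⟨fun X Y _ => Nonempty Y → Nonempty X⟩
  cm2 :=
    { comp_mem := fun _ _ hf hg h => hf (hg h)
      of_postcomp := fun _ g _ hfg ⟨y⟩ => hfg ⟨g y⟩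
      of_precomp := fun f _ _ hfg h => (hfg h).map f }
  cm3a := ⟨fun h hg ⟨b⟩ => (hg ⟨h.i.right b⟩).map h.r.left⟩
  cm3b := ⟨fun {X Y Z W f g} h hg ⟨a⟩ b => by
    obtain ⟨z, hz⟩ := hg ⟨h.i.left a⟩ (h.i.right b)
    have h₁ : f (h.r.left z) = h.r.right (g z) := ConcreteCategory.congr_hom h.r.w z
    have h₂ : h.r.right (h.i.right b) = b := ConcreteCategory.congr_hom h.retract_right b
    exact ⟨h.r.left z, by rw [h₁, hz, h₂]⟩⟩
  cm3c := by
    change injections.IsStableUnderRetracts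
    rw [injections_eq_monomorphisms]
    infer_instance
  cm4a i p hi₁ hi₂ hp := hasLiftingProperty_of_injective i p hi₁.mem
    fun b f => hp.mem ((hi₂.mem ⟨b⟩).map f)
  cm4b i p hi hp₁ hp₂ := hasLiftingProperty_of_injective i p hi.mem
    fun _ _ y => hp₁.mem (hp₂.mem ⟨y⟩) y
  cm5a := ⟨fun {X Y} f => by
    by_cases hX : Nonempty X
    · exact ⟨{
        Z := X ⊕ Y
        i := ↾Sum.inl
        p := ↾Sum.elim f id
        fac := rfl
        hi := ⟨Sum.inl_injective, fun _ => hX⟩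
        hp := fun _ y => ⟨Sum.inr y, rfl⟩ }⟩
    · exact ⟨{
        Z := X
        i := 𝟙 X
        p := f
        hi := ⟨Function.injective_id, id⟩
        hp := fun h => (hX h).elim }⟩⟩
  cm5b := ⟨fun {X Y} f => ⟨{
    Z := X ⊕ Y
    i := ↾Sum.inl
    p := ↾Sum.elim f id
    fac := rfl
    hi := Sum.inl_injective
    hp := ⟨fun _ y => ⟨Sum.inr y, rfl⟩, fun ⟨y⟩ => ⟨Sum.inr y⟩⟩ }⟩⟩

attribute [local instance] nonemptinessModelCategory

lemma trivialFibrations_of_universally_weakEquivalences {X Y : Type u} {p : X ⟶ Y}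
    (hp : universally (weakEquivalences (Type u)) p) : trivialFibrations (Type u) p := by
  refine ⟨fun _ y => ?_, universally_le _ _ hp⟩
  let b : PUnit ⟶ Y := ↾fun _ => y
  obtain ⟨z⟩ := hp _ b _ (IsPullback.of_hasPullback p b).flip ⟨PUnit.unit⟩
  exact ⟨pullback.fst p b z, ConcreteCategory.congr_hom (pullback.condition (f := p) (g := b)) z⟩

lemma trivialCofibrations_of_couniversally_weakEquivalences {A B : (Type u)ᵒᵖ} {i : A ⟶ B}
    (hi : couniversally (weakEquivalences (Type u)ᵒᵖ) i) : trivialCofibrations (Type u)ᵒᵖ i := by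
  rw [trivialCofibrations_op]
  exact trivialFibrations_of_universally_weakEquivalences fun _ _ g g' f sq => by
    simpa [weakEquivalences_op] using hi _ _ _ sq.op

lemma cofibrations_of_isEmpty {K L : Type u} [IsEmpty K] (i : K ⟶ L) : cofibrations (Type u) i :=
  fun a => isEmptyElim a

lemma trivialFibrations_of_nonempty {X : Type u} [Nonempty X] (p : X ⟶ PUnit) :
    trivialFibrations (Type u) p :=
  ⟨fun ⟨x⟩ _ => ⟨x, rfl⟩, fun _ => inferInstance⟩

lemma injective_of_trivialFibrations {A B : Type u} {j : A ⟶ B}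
    (hj : ∀ ⦃K L X Y : Type u⦄ (i : K ⟶ L) (p : X ⟶ Y), cofibrations (Type u) i →
      trivialFibrations (Type u) p → HasLiftingProperty j (pullbackHom i p)) :
    Function.Injective j := by
  let i : PEmpty.{u + 1} ⟶ PUnit := ↾PEmpty.elim
  let p : ULift.{u} Bool ⟶ PUnit := ↾fun _ => PUnit.unit
  have := hj i p (cofibrations_of_isEmpty i) (trivialFibrations_of_nonempty p)
  have : Nontrivial (PUnit.{u + 1} ⟶ ULift.{u} Bool) :=
    TypeCat.homEquiv.nontrivial
  have : Subsingleton (PEmpty.{u + 1} ⟶ ULift.{u} Bool) :=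
    TypeCat.homEquiv.subsingleton
  have : Subsingleton (PUnit.{u + 1} ⟶ PUnit.{u + 1}) :=
    TypeCat.homEquiv.subsingleton
  exact injective_of_hasLiftingProperty_pullbackHom j i p

lemma injective_of_trivialCofibrations_op {A B : Type u} {j : A ⟶ B}
    (hj : ∀ ⦃K L X Y : (Type u)ᵒᵖ⦄ (i : K ⟶ L) (p : X ⟶ Y), trivialCofibrations (Type u)ᵒᵖ i →
      fibrations (Type u)ᵒᵖ p → HasLiftingProperty j (pullbackHom i p)) :
    Function.Injective j := by
  let i : op PUnit.{u + 1} ⟶ op (ULift.{u} Bool) := (↾fun _ => PUnit.unit).op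
  let p : op PUnit.{u + 1} ⟶ op PEmpty.{u + 1} := (↾PEmpty.elim).op
  have hi : trivialCofibrations (Type u)ᵒᵖ i := by
    rw [trivialCofibrations_op]
    exact trivialFibrations_of_nonempty i.unop
  have hp : fibrations (Type u)ᵒᵖ p := by
    rw [fibrations_op]
    exact cofibrations_of_isEmpty p.unop
  have := hj i p hi hp
  have : Nontrivial (op (ULift.{u} Bool) ⟶ op PUnit.{u + 1}) :=
    ((opEquiv _ _).trans TypeCat.homEquiv).nontrivial
  have : Subsingleton (op PUnit.{u + 1} ⟶ op PUnit.{u + 1}) :=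
    ((opEquiv _ _).trans TypeCat.homEquiv).subsingleton
  have : Subsingleton (op (ULift.{u} Bool) ⟶ op PEmpty.{u + 1}) :=
    ((opEquiv _ _).trans TypeCat.homEquiv).subsingleton
  exact injective_of_hasLiftingProperty_pullbackHom j i p

end Nonemptiness

section Characterizations

variable {C : Type u} [SmallCategory C] {deg : C → Ordinal.{v}}

section

variable {M : Type*} [Category.{u} M] [HasColimits M] [HasLimits M] (L R : MorphismProperty M)

lemma reedyLeft_le_inverseImage_weightedColim [IsWeakFactorizationSystem L R]
    [IsWeakFactorizationSystem (reedyLeft deg L) (reedyRight (C := C) deg R)]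
    {U : Cᵒᵖ ⥤ Type u}
    (hU : IsLeftObject (reedyLeft (fun x : Cᵒᵖ => deg x.unop) injections) U) :
    reedyLeft deg L ≤ L.inverseImage (weightedColim U) := by
  rw [isLeftObject_reedyLeft_iff] at hU
  rw [reedyLeft_le_inverseImage_weightedColim_iff deg L R]
  intro x _ _ _ _ i p hi hp
  have := hasLiftingProperty_of_wfs i p hi hp
  exact hasLiftingProperty_pullbackHom_of_injective (hU x) i p

lemma reedyRight_le_inverseImage_weightedLim [IsWeakFactorizationSystem L R]
    [IsWeakFactorizationSystem (reedyLeft deg L) (reedyRight (C := C) deg R)]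
    {W : C ⥤ Type u}
    (hW : IsLeftObject (reedyLeft deg injections) W) :
    reedyRight deg R ≤ R.inverseImage (weightedLim W) := by
  rw [isLeftObject_reedyLeft_iff] at hW
  rw [reedyRight_le_inverseImage_weightedLim_iff deg L R]
  intro x _ _ _ _ i p hi hp
  have := hasLiftingProperty_of_wfs i p hi hp
  exact hasLiftingProperty_pullbackHom_of_injective (hW x) i p

end

theorem couniversally_weightedColim_iff
    (hM : ∀ (M : Type (u + 1)) [Category.{u} M] [HasLimits M] [HasColimits M] [ModelCategory M],
      IsWeakFactorizationSystem (reedyLeft (C := C) deg (trivialCofibrations M))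
        (reedyRight deg (fibrations M)))
    (U : Cᵒᵖ ⥤ Type u) :
    (∀ (M : Type (u + 1)) [Category.{u} M] [HasLimits M] [HasColimits M] [ModelCategory M]
        ⦃A B : C ⥤ M⦄ (f : A ⟶ B), reedyLeft deg (trivialCofibrations M) f →
          couniversally (weakEquivalences M) ((weightedColim U).map f)) ↔
      IsLeftObject (reedyLeft (fun x : Cᵒᵖ => deg x.unop) injections) U := by
  refine ⟨fun h => ?_, fun hU M _ _ _ _ A B f hf _ _ _ _ _ sq => ?_⟩
  · let := nonemptinessModelCategory.{u}
    have := hM (Type u)ᵒᵖ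
    have hcolim : reedyLeft deg (trivialCofibrations (Type u)ᵒᵖ) ≤
        (trivialCofibrations (Type u)ᵒᵖ).inverseImage (weightedColim U) :=
      fun _ _ f hf => trivialCofibrations_of_couniversally_weakEquivalences (h _ f hf)
    rw [reedyLeft_le_inverseImage_weightedColim_iff deg _ (fibrations (Type u)ᵒᵖ)] at hcolim
    rw [isLeftObject_reedyLeft_iff]
    exact fun x => injective_of_trivialCofibrations_op (hcolim x)
  · have := hM M
    have hf' : trivialCofibrations M ((weightedColim U).map f) :=
      reedyLeft_le_inverseImage_weightedColim (trivialCofibrations M) (fibrations M) hU f hf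
    exact (MorphismProperty.of_isPushout sq.flip hf').2

theorem universally_weightedLim_iff
    (hM : ∀ (M : Type (u + 1)) [Category.{u} M] [HasLimits M] [HasColimits M] [ModelCategory M],
      IsWeakFactorizationSystem (reedyLeft (C := C) deg (cofibrations M))
        (reedyRight deg (trivialFibrations M)))
    (W : C ⥤ Type u) :
    (∀ (M : Type (u + 1)) [Category.{u} M] [HasLimits M] [HasColimits M] [ModelCategory M]
        ⦃A B : C ⥤ M⦄ (f : A ⟶ B), reedyRight deg (trivialFibrations M) f →
          universally (weakEquivalences M) ((weightedLim W).map f)) ↔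
      IsLeftObject (reedyLeft deg injections) W := by
  refine ⟨fun h => ?_, fun hW M _ _ _ _ A B f hf _ _ _ _ _ sq => ?_⟩
  · let := nonemptinessModelCategory.{u}
    have := hM (Type u)
    have hlim : reedyRight deg (trivialFibrations (Type u)) ≤
        (trivialFibrations (Type u)).inverseImage (weightedLim W) :=
      fun _ _ f hf => trivialFibrations_of_universally_weakEquivalences (h _ f hf)
    rw [reedyRight_le_inverseImage_weightedLim_iff deg (cofibrations (Type u))] at hlim
    rw [isLeftObject_reedyLeft_iff]
    exact fun x => injective_of_trivialFibrations (hlim x)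
  · have := hM M
    have hf' : trivialFibrations M ((weightedLim W).map f) :=
      reedyRight_le_inverseImage_weightedLim (cofibrations M) (trivialFibrations M) hW f hf
    exact (MorphismProperty.of_isPullback sq.flip hf').2

end Characterizations

theorem mainTheorem3_general {C : Type u} [SmallCategory C] (deg : C → Ordinal.{v})
    (h₁ : ∀ (M : Type (u + 1)) [Category.{u} M] [HasLimits M] [HasColimits M] [ModelCategory M],
      IsWeakFactorizationSystem (reedyLeft (C := C) deg (trivialCofibrations M))
        (reedyRight deg (fibrations M)))
    (h₂ : ∀ (M : Type (u + 1)) [Category.{u} M] [HasLimits M] [HasColimits M] [ModelCategory M],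
      IsWeakFactorizationSystem (reedyLeft (C := C) deg (cofibrations M))
        (reedyRight deg (trivialFibrations M)))
    (U : Cᵒᵖ ⥤ Type u) (W : C ⥤ Type u) :
    ((∀ (M : Type (u + 1)) [Category.{u} M] [HasLimits M] [HasColimits M] [ModelCategory M]
        ⦃A B : C ⥤ M⦄ (f : A ⟶ B), reedyLeft deg (trivialCofibrations M) f →
          couniversally (weakEquivalences M) ((weightedColim U).map f)) ↔
      IsLeftObject (reedyLeft (fun x : Cᵒᵖ => deg x.unop) injections) U) ∧
    ((∀ (M : Type (u + 1)) [Category.{u} M] [HasLimits M] [HasColimits M] [ModelCategory M]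
        ⦃A B : C ⥤ M⦄ (f : A ⟶ B), reedyRight deg (trivialFibrations M) f →
          universally (weakEquivalences M) ((weightedLim W).map f)) ↔
      IsLeftObject (reedyLeft deg injections) W) :=
  ⟨couniversally_weightedColim_iff h₁ U, universally_weightedLim_iff h₂ W⟩

theorem mainTheorem3 {C : Type u} [SmallCategory C] (deg : C → Ordinal.{v})
    (hC : IsBistratifiedDiscrete deg)
    (hM : ∀ (M : Type (u + 1)) [Category.{u} M] [HasLimits M] [HasColimits M] [ModelCategory M],
      FormModelStructure
        (reedyLeft deg (trivialCofibrations M)) (reedyRight deg (fibrations M))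
        (reedyLeft deg (cofibrations M)) (reedyRight deg (trivialFibrations M))
        ((weakEquivalences M).functorCategory C))
    (U : Cᵒᵖ ⥤ Type u) (W : C ⥤ Type u) :
    ((∀ (M : Type (u + 1)) [Category.{u} M] [HasLimits M] [HasColimits M] [ModelCategory M]
        ⦃A B : C ⥤ M⦄ (f : A ⟶ B), reedyLeft deg (trivialCofibrations M) f →
          couniversally (weakEquivalences M) ((weightedColim U).map f)) ↔
      IsLeftObject (reedyLeft (fun x : Cᵒᵖ => deg x.unop) injections) U) ∧
    ((∀ (M : Type (u + 1)) [Category.{u} M] [HasLimits M] [HasColimits M] [ModelCategory M]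
        ⦃A B : C ⥤ M⦄ (f : A ⟶ B), reedyRight deg (trivialFibrations M) f →
          universally (weakEquivalences M) ((weightedLim W).map f)) ↔
      IsLeftObject (reedyLeft deg injections) W) :=
  mainTheorem3_general deg (fun M _ _ _ _ => (hM M).wfs₁) (fun M _ _ _ _ => (hM M).wfs₂) U W
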